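/- Write $[n]=1+q+\cdots+q^{n-1}$ and $[n]!=[n][n-1]\cdots[1]$. For integers $n\ge0$ and $k$ let ${n\brack k}=\prod_{i=1}^k\frac{1-q^{n-i+1}}{1-q^i}$ if $k\ge0$ and ${n\brack k}=0$ if $k<0$. For $n,k\ge0$ let $A_{n,k}(q)={2n\brack n-k}-{2n\brack n-k-1}$ be the $q$-ballot numbers (so $A_{n,k}(q)=q^{n-k}\frac{[2k+1]}{[2n+1]}{2n+1\brack n-k}$ for $k\le n$, and $A_{n,k}(q)=0$ for $k>n$), and let $A_{n,k}=A_{n,k}(1)=\binom{2n}{n-k}-\binom{2n}{n-k-1}$. Theorem 1.4. Let $m,n,s,t\ge1$ and $j,r\ge0$ be integers with $r+s+t$ odd and $j\le s+t$. Then the $q$-super Catalan number $\frac{[2m]![2n]!}{[m+n]![m]![n]!}$ is a polynomial in $q$ with integer coefficients, and, in the ring $\mathbb{Z}[q,q^{-1}]$ of Laurent polynomials with integer coefficients, it divides each of $$[m+n+1]\sum_{k=0}^m q^{j(k^2+k)-rk}[2k+1]^rA_{m,k}(q)^sA_{n,k}(q)^t,$$ $$[m+n+1]\sum_{k=0}^m(-1)^k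 q^{\binom k2+j(k^2+k)-(r-1)k}[2k+1]^rA_{m,k}(q)^sA_{n,k}(q)^t.$$ In particular, at $q=1$, the super Catalan number $\frac{(2m)!(2n)!}{(m+n)!\,m!\,n!}$ is an integer, and it divides each of the integers $$(m+n+1)\sum_{k=0}^m(2k+1)^rA_{m,k}^sA_{n,k}^t,\qquad (m+n+1)\sum_{k=0}^m(-1)^k(2k+1)^rA_{m,k}^sA_{n,k}^t.$$ -/

import Mathlib

open Polynomial

noncomputable section

namespace QBallot

/-- The `q`-integer `[n] = 1 + q + ⋯ + q^(n-1)`; the indeterminate `q` is `X`. -/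
def qInt (n : ℕ) : ℤ[X] := ∑ i ∈ Finset.range n, X ^ i

/-- The `q`-factorial `[n]! = [n][n-1]⋯[1]`. -/
def qFactorial (n : ℕ) : ℤ[X] := ∏ i ∈ Finset.range n, qInt (i + 1)

/-- The numerator `∏_{i=1}^k (q^(n-i+1) - 1)` of the `q`-binomial coefficient
(for `k > n` the factor with `i = n + 1` is zero). -/
def qBinomNum (n k : ℕ) : ℤ[X] := ∏ i ∈ Finset.range k, (X ^ (n - i) - 1)

/-- The denominator `∏_{i=1}^k (q^i - 1)` of the `q`-binomial coefficient. -/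
def qBinomDen (k : ℕ) : ℤ[X] := ∏ i ∈ Finset.range k, (X ^ (i + 1) - 1)

/-- The `q`-binomial coefficient `∏_{i=1}^k (1 - q^(n-i+1)) / (1 - q^i)` if `k ≥ 0`, and `0` if
`k < 0`. The signs in numerator and denominator cancel; the division by the monic denominator is
exact, see `qBinomDen_mul_qBinom`. -/
def qBinom (n : ℕ) (k : ℤ) : ℤ[X] :=
  if 0 ≤ k then qBinomNum n k.toNat /ₘ qBinomDen k.toNat else 0

/-- The `q`-ballot number `A_{n,k}(q)`, a difference of two `q`-binomial coefficients.
It vanishes for `k > n`. -/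
def qBallot (n k : ℕ) : ℤ[X] :=
  qBinom (2 * n) ((n : ℤ) - k) - qBinom (2 * n) ((n : ℤ) - k - 1)

/-- The denominator `[m+n]! [m]! [n]!` of the `q`-super Catalan number. -/
def qSuperCatalanDen (m n : ℕ) : ℤ[X] := qFactorial (m + n) * qFactorial m * qFactorial n

/-- The `q`-super Catalan number `[2m]! [2n]! / ([m+n]! [m]! [n]!)`, as the quotient by a monic
polynomial (`qSuperCatalanDen_monic`). -/
def qSuperCatalan (m n : ℕ) : ℤ[X] :=
  (qFactorial (2 * m) * qFactorial (2 * n)) /ₘ qSuperCatalanDen m n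

/-- The binomial coefficient with integer lower index, zero if that index is negative. -/
def binom (n : ℕ) (k : ℤ) : ℤ := if 0 ≤ k then (n.choose k.toNat : ℤ) else 0

/-- The ballot number `A_{n,k}`. -/
def ballot (n k : ℕ) : ℤ :=
  binom (2 * n) ((n : ℤ) - k) - binom (2 * n) ((n : ℤ) - k - 1)

/-- The super Catalan number `(2m)! (2n)! / ((m+n)! m! n!)`. -/
def superCatalan (m n : ℕ) : ℕ :=
  ((2 * m).factorial * (2 * n).factorial) / ((m + n).factorial * m.factorial * n.factorial)

theorem qBinomNum_eq_zero {n k : ℕ} (h : n < k) : qBinomNum n k = 0 :=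
  Finset.prod_eq_zero (Finset.mem_range.2 h) (by simp)

theorem qBinomNum_pascal (n k : ℕ) :
    qBinomNum (n + 1) (k + 1) =
      (X ^ (k + 1) - 1) * qBinomNum n k + X ^ (k + 1) * qBinomNum n (k + 1) := by
  have h1 : qBinomNum (n + 1) (k + 1) = qBinomNum n k * (X ^ (n + 1) - 1) := by
    simp [qBinomNum, Finset.prod_range_succ']
  have h2 : qBinomNum n (k + 1) = qBinomNum n k * (X ^ (n - k) - 1) := by
    simp [qBinomNum, Finset.prod_range_succ]
  rw [h1, h2]
  by_cases h : k ≤ n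
  · obtain ⟨d, rfl⟩ := Nat.exists_eq_add_of_le h
    rw [Nat.add_sub_cancel_left]
    ring
  · rw [qBinomNum_eq_zero (not_le.1 h)]
    ring

theorem qBinomDen_monic (k : ℕ) : (qBinomDen k).Monic :=
  monic_prod_of_monic _ _ fun i _ => by simpa using monic_X_pow_sub_C (1 : ℤ) (Nat.succ_ne_zero i)

theorem qBinomDen_dvd (n k : ℕ) : qBinomDen k ∣ qBinomNum n k := by
  induction n generalizing k with
  | zero =>
    cases k with
    | zero => simp [qBinomDen]
    | succ k => rw [qBinomNum_eq_zero (Nat.succ_pos k)]; exact dvd_zero _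
  | succ n ih =>
    cases k with
    | zero => simp [qBinomDen]
    | succ k =>
      rw [qBinomNum_pascal]
      refine dvd_add ?_ (Dvd.dvd.mul_left (ih (k + 1)) _)
      rw [qBinomDen, Finset.prod_range_succ, mul_comm]
      exact mul_dvd_mul_left _ (ih k)

/-- The division in the definition of the `q`-binomial coefficient is exact. -/
theorem qBinomDen_mul_qBinom (n k : ℕ) : qBinomDen k * qBinom n k = qBinomNum n k := by
  have h := (modByMonic_eq_zero_iff_dvd (qBinomDen_monic k)).2 (qBinomDen_dvd n k)
  have h' := modByMonic_add_div (qBinomNum n k) (qBinomDen k)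
  rw [h, zero_add] at h'
  simpa [qBinom] using h'

theorem qInt_succ_monic (n : ℕ) : (qInt (n + 1)).Monic :=
  monic_geom_sum_X (Nat.succ_ne_zero n)

theorem qFactorial_monic (n : ℕ) : (qFactorial n).Monic :=
  monic_prod_of_monic _ _ fun i _ => qInt_succ_monic i

theorem qSuperCatalanDen_monic (m n : ℕ) : (qSuperCatalanDen m n).Monic :=
  ((qFactorial_monic _).mul (qFactorial_monic _)).mul (qFactorial_monic _)

/-- A polynomial in `q` viewed as a Laurent polynomial in `q`. -/
abbrev toL (p : ℤ[X]) : LaurentPolynomial ℤ := Polynomial.toLaurent p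

/-- The Laurent monomial `q^e`, with `e` an integer. -/
abbrev qPow (e : ℤ) : LaurentPolynomial ℤ := LaurentPolynomial.T e

/-- The sum `∑_{k=0}^m q^(j(k²+k) - rk) [2k+1]^r A_{m,k}(q)^s A_{n,k}(q)^t`. -/
def qSum (m n s t j r : ℕ) : LaurentPolynomial ℤ :=
  ∑ k ∈ Finset.range (m + 1),
    qPow ((j : ℤ) * ((k : ℤ) ^ 2 + k) - (r : ℤ) * k) *
      toL (qInt (2 * k + 1) ^ r * qBallot m k ^ s * qBallot n k ^ t)

/-- The alternating sum
`∑_{k=0}^m (-1)^k q^(C(k,2) + j(k²+k) - (r-1)k) [2k+1]^r A_{m,k}(q)^s A_{n,k}(q)^t`. -/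
def qAltSum (m n s t j r : ℕ) : LaurentPolynomial ℤ :=
  ∑ k ∈ Finset.range (m + 1),
    (-1) ^ k * qPow ((k.choose 2 : ℤ) + (j : ℤ) * ((k : ℤ) ^ 2 + k) - ((r : ℤ) - 1) * k) *
      toL (qInt (2 * k + 1) ^ r * qBallot m k ^ s * qBallot n k ^ t)

end QBallot

end

namespace QBallot

/-! The `q`-super Catalan number is a product of distinct cyclotomic polynomials Φ_d: with μ = m mod
d and ν = n mod d, the exponent of Φ_d is [2μ ≥ d] + [2ν ≥ d] - [μ + ν ≥ d], which is 0 or 1. So it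
suffices that [m+n+1] times the sum vanishes at every primitive d-th root of unity ζ for which this
exponent is 1.

The `q`-Lucas theorem gives the values of the ballot numbers at ζ, and three cases remain. If 2μ ≥ d
and 2ν ≥ d, the reflection k ↔ d - 1 - k inside each block of d consecutive indices changes the sign
of A_m, of A_n and of q^(-k)[2k+1] and fixes the remaining weight; as r + s + t is odd, the terms
cancel in pairs. If only one of the two holds and μ + ν + 1 < d, then A_{m,k} A_{n,k} vanishes at ζ
for every k. If μ + ν + 1 = d, then d divides m + n + 1 and the factor [m+n+1] vanishes. The integer
statements follow by evaluation at q = 1. -/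

/-! ### Cyclotomic factorization of the `q`-super Catalan number -/

theorem qInt_succ_eq_prod_cyclotomic {n N : ℕ} (h : n < N) :
    qInt (n + 1) = ∏ d ∈ Finset.Icc 2 N, cyclotomic d ℤ ^ (if d ∣ n + 1 then 1 else 0) := by
  rw [qInt, ← prod_cyclotomic_eq_geom_sum (Nat.succ_pos n) ℤ]
  simp only [pow_ite, pow_one, pow_zero]
  rw [← Finset.prod_filter]
  refine Finset.prod_congr (Finset.ext fun d => ?_) fun _ _ => rfl
  simp only [Finset.mem_erase, Nat.mem_divisors, Finset.mem_filter, Finset.mem_Icc]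
  constructor
  · rintro ⟨h1, h2, -⟩
    have := Nat.le_of_dvd (Nat.succ_pos n) h2
    have := Nat.pos_of_dvd_of_pos h2 (Nat.succ_pos n)
    exact ⟨⟨by omega, by omega⟩, h2⟩
  · rintro ⟨⟨h1, -⟩, h2⟩
    exact ⟨by omega, h2, by omega⟩

theorem qFactorial_eq_prod_cyclotomic {n N : ℕ} (h : n ≤ N) :
    qFactorial n = ∏ d ∈ Finset.Icc 2 N, cyclotomic d ℤ ^ (n / d) := by
  induction n with
  | zero => simp [qFactorial]
  | succ n ih =>
    rw [show qFactorial (n + 1) = qFactorial n * qInt (n + 1) from Finset.prod_range_succ _ _,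
      ih (by omega), qInt_succ_eq_prod_cyclotomic h, ← Finset.prod_mul_distrib]
    refine Finset.prod_congr rfl fun d _ => ?_
    rw [← pow_add, Nat.succ_div]

/-- The indices of the cyclotomic factors of the `q`-super Catalan number. -/
def superCatalanIndices (m n : ℕ) : Finset ℕ :=
  (Finset.Icc 2 (2 * (m + n))).filter fun d =>
    (d ≤ 2 * (m % d) ∨ d ≤ 2 * (n % d)) ∧
      (m % d + n % d < d ∨ (d ≤ 2 * (m % d) ∧ d ≤ 2 * (n % d)))

theorem two_mul_div {m d : ℕ} (hd : 0 < d) :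
    2 * m / d = 2 * (m / d) + if d ≤ 2 * (m % d) then 1 else 0 := by
  have h := Nat.div_add_mod m d
  have h0 := Nat.mod_lt m hd
  have h2 : 2 * m = 2 * (m % d) + d * (2 * (m / d)) := by linarith
  rw [h2, Nat.add_mul_div_left _ _ hd, add_comm]
  congr 1
  split_ifs with h3
  · exact Nat.div_eq_of_lt_le (by omega) (by omega)
  · exact Nat.div_eq_of_lt (by omega)

/-- Compares exponents of each Φ_d: [N]! contributes ⌊N/d⌋, and doubling or adding arguments
produces carries determined by the residues mod d. The common bound 2(m + n) lets all the
factorizations run over one index set. -/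
theorem qFactorial_two_mul_mul (m n : ℕ) :
    qSuperCatalanDen m n * ∏ d ∈ superCatalanIndices m n, cyclotomic d ℤ =
      qFactorial (2 * m) * qFactorial (2 * n) := by
  rw [qSuperCatalanDen, qFactorial_eq_prod_cyclotomic (show m + n ≤ 2 * (m + n) by omega),
    qFactorial_eq_prod_cyclotomic (show m ≤ 2 * (m + n) by omega),
    qFactorial_eq_prod_cyclotomic (show n ≤ 2 * (m + n) by omega),
    qFactorial_eq_prod_cyclotomic (show 2 * m ≤ 2 * (m + n) by omega),
    qFactorial_eq_prod_cyclotomic (show 2 * n ≤ 2 * (m + n) by omega),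
    superCatalanIndices, Finset.prod_filter]
  simp only [← Finset.prod_mul_distrib]
  refine Finset.prod_congr rfl fun d hd => ?_
  have hd0 : 0 < d := by have := (Finset.mem_Icc.1 hd).1; omega
  have h0 := Nat.mod_lt m hd0
  have h1 := Nat.mod_lt n hd0
  rw [← pow_one (cyclotomic d ℤ), ← pow_zero (cyclotomic d ℤ), ← pow_ite]
  simp only [pow_one, ← pow_add]
  congr 1
  rw [two_mul_div hd0, two_mul_div hd0, Nat.add_div hd0]
  split_ifs <;> omega

theorem qSuperCatalan_eq_prod_cyclotomic (m n : ℕ) :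
    qSuperCatalan m n = ∏ d ∈ superCatalanIndices m n, cyclotomic d ℤ := by
  rw [qSuperCatalan, ← qFactorial_two_mul_mul,
    mul_divByMonic_cancel_left _ (qSuperCatalanDen_monic m n)]

theorem qSuperCatalanDen_mul_qSuperCatalan (m n : ℕ) :
    qSuperCatalanDen m n * qSuperCatalan m n = qFactorial (2 * m) * qFactorial (2 * n) := by
  rw [qSuperCatalan_eq_prod_cyclotomic, qFactorial_two_mul_mul]

/-- A product of distinct cyclotomic polynomials divides every polynomial that is divisible by
each of them. -/
theorem prod_cyclotomic_dvd {s : Finset ℕ} (hs : ∀ d ∈ s, 0 < d) {p : ℤ[X]}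
    (h : ∀ d ∈ s, cyclotomic d ℤ ∣ p) : ∏ d ∈ s, cyclotomic d ℤ ∣ p := by
  refine Finset.prod_dvd_of_isRelPrime (fun a ha b hb hab => ?_) h
  refine ((cyclotomic.irreducible (hs a ha)).isRelPrime_iff_not_dvd).2 fun hdvd => hab ?_
  exact cyclotomic_injective (R := ℤ) (eq_of_monic_of_associated (cyclotomic.monic a ℤ)
    (cyclotomic.monic b ℤ) ((cyclotomic.irreducible (hs a ha)).associated_of_dvd
      (cyclotomic.irreducible (hs b hb)) hdvd))

/-! ### Divisibility tested at roots of unity -/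

/-- Evaluation of an integral Laurent polynomial at a unit. -/
noncomputable def evalL {R : Type*} [CommRing R] (u : Rˣ) : LaurentPolynomial ℤ →+* R :=
  LaurentPolynomial.eval₂ (Int.castRingHom R) u

theorem evalL_toL {R : Type*} [CommRing R] (u : Rˣ) (p : ℤ[X]) :
    evalL u (toL p) = aeval (u : R) p := by
  rw [evalL, LaurentPolynomial.eval₂_toLaurent, aeval_def]; rfl

theorem evalL_qPow {R : Type*} [CommRing R] (u : Rˣ) (e : ℤ) :
    evalL u (qPow e) = ((u ^ e : Rˣ) : R) :=
  LaurentPolynomial.eval₂_T _ _ _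

/-- A Laurent polynomial that vanishes at the primitive `d`-th roots of unity for all indices `d` of
the `q`-super Catalan number is divisible by that number. -/
theorem toL_qSuperCatalan_dvd {m n : ℕ} {f : LaurentPolynomial ℤ}
    (h : ∀ d ∈ superCatalanIndices m n, ∀ u : ℂˣ, IsPrimitiveRoot (u : ℂ) d → evalL u f = 0) :
    toL (qSuperCatalan m n) ∣ f := by
  -- Multiplying by the unit q^N reduces the claim to an ordinary polynomial.
  obtain ⟨N, p, hp⟩ := f.exists_T_pow
  have hpos : ∀ d ∈ superCatalanIndices m n, 0 < d := fun d hd => by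
    have := (Finset.mem_Icc.1 (Finset.mem_filter.1 hd).1).1
    omega
  have hdvd : qSuperCatalan m n ∣ p := by
    rw [qSuperCatalan_eq_prod_cyclotomic]
    refine prod_cyclotomic_dvd hpos fun d hd => ?_
    have hζ := Complex.isPrimitiveRoot_exp d (hpos d hd).ne'
    rw [cyclotomic_eq_minpoly hζ (hpos d hd)]
    refine minpoly.isIntegrallyClosed_dvd (hζ.isIntegral (hpos d hd)) ?_
    have := evalL_toL (hζ.isUnit (hpos d hd).ne').unit p
    rw [toL, hp, map_mul, h d hd _ hζ, zero_mul] at this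
    exact this.symm
  have := map_dvd (toLaurent (R := ℤ)) hdvd
  rw [hp] at this
  exact (LaurentPolynomial.isUnit_T (R := ℤ) N).dvd_mul_right.1 this

/-! ### Identities for `q`-binomial and binomial coefficients -/

theorem qBinom_of_neg {k : ℤ} (n : ℕ) (h : k < 0) : qBinom n k = 0 := if_neg (not_le.2 h)

theorem qBinomDen_succ (k : ℕ) : qBinomDen (k + 1) = qBinomDen k * (X ^ (k + 1) - 1) :=
  Finset.prod_range_succ _ _

theorem qBinom_zero (n : ℕ) : qBinom n 0 = 1 := by
  simp [qBinom, qBinomNum, qBinomDen]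

theorem qBinom_of_lt {n : ℕ} {k : ℤ} (h : (n : ℤ) < k) : qBinom n k = 0 := by
  lift k to ℕ using by omega
  rw [← (qBinomDen_monic k).mul_right_eq_zero_iff, qBinomDen_mul_qBinom,
    qBinomNum_eq_zero (by exact_mod_cast h)]

theorem qBinom_succ (n k : ℕ) :
    qBinom (n + 1) ((k + 1 : ℕ) : ℤ) =
      qBinom n k + X ^ (k + 1) * qBinom n ((k + 1 : ℕ) : ℤ) := by
  refine (qBinomDen_monic (k + 1)).isRegular.left ?_
  simp only
  rw [qBinomDen_mul_qBinom, qBinomNum_pascal, ← qBinomDen_mul_qBinom n k,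
    ← qBinomDen_mul_qBinom n (k + 1), qBinomDen_succ]
  ring

theorem qBinomNum_mul_qBinomDen (k l : ℕ) :
    qBinomNum (k + l) k * qBinomDen l = qBinomDen (k + l) := by
  induction k with
  | zero => simp [qBinomNum]
  | succ k ih =>
    have h : qBinomNum (k + l + 1) (k + 1) = qBinomNum (k + l) k * (X ^ (k + l + 1) - 1) := by
      simp [qBinomNum, Finset.prod_range_succ']
    rw [show k + 1 + l = k + l + 1 by ring, h, qBinomDen_succ, ← ih]
    ring

theorem qBinomDen_mul_mul_qBinom (k l : ℕ) :
    qBinomDen k * qBinomDen l * qBinom (k + l) k = qBinomDen (k + l) := by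
  rw [mul_right_comm, qBinomDen_mul_qBinom, qBinomNum_mul_qBinomDen]

theorem qBinom_symm {n : ℕ} {i j : ℤ} (h : i + j = n) : qBinom n i = qBinom n j := by
  rcases lt_or_ge i 0 with hi | hi
  · rw [qBinom_of_neg n hi, qBinom_of_lt (by omega)]
  rcases lt_or_ge j 0 with hj | hj
  · rw [qBinom_of_neg n hj, qBinom_of_lt (by omega)]
  lift i to ℕ using hi
  lift j to ℕ using hj
  obtain rfl : i + j = n := by exact_mod_cast h
  refine ((qBinomDen_monic i).mul (qBinomDen_monic j)).isRegular.left ?_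
  simp only
  rw [qBinomDen_mul_mul_qBinom, mul_comm (qBinomDen i), add_comm i, qBinomDen_mul_mul_qBinom]

theorem qBallot_of_lt {n k : ℕ} (h : n < k) : qBallot n k = 0 := by
  rw [qBallot, qBinom_of_neg _ (by omega), qBinom_of_neg _ (by omega), sub_zero]

theorem binom_of_neg {k : ℤ} (n : ℕ) (h : k < 0) : binom n k = 0 := if_neg (not_le.2 h)

theorem binom_natCast (n k : ℕ) : binom n k = n.choose k := by simp [binom]

theorem binom_succ (n : ℕ) (k : ℤ) : binom (n + 1) k = binom n (k - 1) + binom n k := by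
  rcases lt_or_ge k 0 with h | h
  · rw [binom_of_neg _ h, binom_of_neg _ h, binom_of_neg _ (by omega), add_zero]
  lift k to ℕ using h
  cases k with
  | zero => rw [binom_of_neg n (by simp), binom_natCast, binom_natCast]; simp
  | succ k =>
    rw [Nat.cast_succ, add_sub_cancel_right, ← Nat.cast_succ, binom_natCast, binom_natCast,
      binom_natCast]
    exact_mod_cast Nat.choose_succ_succ n k

/-! ### The `q`-Lucas theorem -/

variable {K : Type*} [Field K] {ζ : K} {d : ℕ}

/-- The numerator contains ζ^d - 1 = 0, while no factor ζ^i - 1 of the denominator vanishes for i ≤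
e < d. -/
theorem aeval_qBinom_self_eq_zero (hζ : IsPrimitiveRoot ζ d) {e : ℕ} (he : 0 < e) (hed : e < d) :
    aeval ζ (qBinom d e) = 0 := by
  have h := congrArg (aeval ζ) (qBinomDen_mul_qBinom d e)
  have h0 : aeval ζ (qBinomNum d e) = 0 := by
    rw [qBinomNum, map_prod]
    exact Finset.prod_eq_zero (Finset.mem_range.2 he) (by simp [hζ.pow_eq_one])
  rw [map_mul, h0] at h
  refine (mul_eq_zero.1 h).resolve_left ?_
  rw [qBinomDen, map_prod]
  refine Finset.prod_ne_zero_iff.2 fun i hi => ?_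
  have := hζ.pow_ne_one_of_pos_of_lt (Nat.succ_ne_zero i) (by
    have := Finset.mem_range.1 hi; omega)
  simpa [sub_eq_zero] using this

theorem aeval_qBinom_succ (ζ : K) (n : ℕ) (k : ℤ) :
    aeval ζ (qBinom (n + 1) k) = aeval ζ (qBinom n (k - 1)) + ζ ^ k * aeval ζ (qBinom n k) := by
  rcases lt_or_ge k 0 with h | h
  · rw [qBinom_of_neg _ h, qBinom_of_neg _ h, qBinom_of_neg _ (by omega)]; simp
  lift k to ℕ using h
  cases k with
  | zero => rw [qBinom_of_neg n (by simp), Nat.cast_zero, qBinom_zero, qBinom_zero]; simp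
  | succ k =>
    rw [qBinom_succ, Nat.cast_succ, add_sub_cancel_right, ← Nat.cast_succ, zpow_natCast]
    simp

/-- The `q`-Lucas theorem. -/
theorem aeval_qBinom_lucas (hζ : IsPrimitiveRoot ζ d) (a : ℕ) {b : ℕ} (hb : b < d) (c : ℤ)
    {e : ℕ} (he : e < d) :
    aeval ζ (qBinom (a * d + b) (c * d + e)) = binom a c * aeval ζ (qBinom b e) := by
  have hd : 0 < d := by omega
  have hζ0 : ζ ≠ 0 := hζ.ne_zero hd.ne'
  have hpow : ∀ (c : ℤ) (e : ℕ), ζ ^ (c * d + e) = ζ ^ (e : ℤ) := fun c e => by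
    rw [zpow_add₀ hζ0, mul_comm c, zpow_mul, zpow_natCast ζ d, hζ.pow_eq_one, one_zpow, one_mul]
  suffices H : ∀ N a b : ℕ, N = a * d + b → b < d → ∀ (c : ℤ) (e : ℕ), e < d →
      aeval ζ (qBinom N (c * d + e)) = binom a c * aeval ζ (qBinom b e) from
    H _ a b rfl hb c e he
  intro N
  induction N with
  | zero =>
    intro a b hN hb c e he
    obtain ⟨ha, rfl⟩ : a * d = 0 ∧ b = 0 := by omega
    obtain rfl : a = 0 := (Nat.mul_eq_zero.1 ha).resolve_right hd.ne'
    rcases lt_trichotomy c 0 with hc | rfl | hc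
    · rw [binom_of_neg _ hc, qBinom_of_neg _ (by nlinarith)]; simp
    · rw [show binom 0 0 = 1 from binom_natCast 0 0]; simp
    · rw [qBinom_of_lt (by push_cast; nlinarith)]
      lift c to ℕ using hc.le
      rw [binom_natCast, Nat.choose_eq_zero_of_lt (by omega)]; simp
  | succ N ih =>
    intro a b hN hb c e he
    rw [aeval_qBinom_succ ζ, hpow]
    -- For b = 0 the step down to N borrows from the quotient, leaving remainder d - 1. Then e = 0
    -- yields the ordinary Pascal rule for the binomial factor, and e > 0 gives a multiple of the
    -- vanishing coefficient of d over e.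
    rcases Nat.eq_zero_or_pos b with rfl | hb0
    · obtain ⟨a, rfl⟩ : ∃ a', a = a' + 1 := ⟨a - 1, by
        rcases Nat.eq_zero_or_pos a with rfl | h <;> omega⟩
      have hN' : N = a * d + (d - 1) := by
        have : (a + 1) * d = a * d + d := by ring
        omega
      rw [ih a (d - 1) hN' (by omega) c e he]
      rcases Nat.eq_zero_or_pos e with rfl | he0
      · rw [show c * d + ((0 : ℕ) : ℤ) - 1 = (c - 1) * d + ((d - 1 : ℕ) : ℤ) by
            rw [Nat.cast_sub (by omega)]; push_cast; ring,
          ih a (d - 1) hN' (by omega) (c - 1) (d - 1) (by omega),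
          qBinom_symm (show ((d - 1 : ℕ) : ℤ) + 0 = (d - 1 : ℕ) by simp), binom_succ]
        simp [qBinom_zero]
      · obtain ⟨e, rfl⟩ : ∃ e', e = e' + 1 := ⟨e - 1, by omega⟩
        rw [show c * d + ((e + 1 : ℕ) : ℤ) - 1 = c * d + (e : ℤ) by push_cast; ring,
          ih a (d - 1) hN' (by omega) c e (by omega), mul_left_comm, ← mul_add]
        have h := aeval_qBinom_succ ζ (d - 1) ((e + 1 : ℕ) : ℤ)
        rw [Nat.sub_add_cancel hd, aeval_qBinom_self_eq_zero hζ he0 he, Nat.cast_succ,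
          add_sub_cancel_right] at h
        rw [Nat.cast_succ, ← h, qBinom_of_lt (by omega)]
        simp
    · obtain ⟨b, rfl⟩ : ∃ b', b = b' + 1 := ⟨b - 1, by omega⟩
      have hN' : N = a * d + b := by omega
      rw [ih a b hN' (by omega) c e he, aeval_qBinom_succ ζ]
      -- For e = 0 the lower index borrows to remainder d - 1, which exceeds b, so that term of the
      -- Pascal rule vanishes.
      rcases Nat.eq_zero_or_pos e with rfl | he0
      · rw [show c * d + ((0 : ℕ) : ℤ) - 1 = (c - 1) * d + ((d - 1 : ℕ) : ℤ) by
            rw [Nat.cast_sub (by omega)]; push_cast; ring,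
          ih a b hN' (by omega) (c - 1) (d - 1) (by omega),
          qBinom_of_lt (show (b : ℤ) < (d - 1 : ℕ) by omega),
          qBinom_of_neg b (show ((0 : ℕ) : ℤ) - 1 < 0 by simp)]
        simp
      · obtain ⟨e, rfl⟩ : ∃ e', e = e' + 1 := ⟨e - 1, by omega⟩
        rw [show c * d + ((e + 1 : ℕ) : ℤ) - 1 = c * d + (e : ℤ) by push_cast; ring,
          ih a b hN' (by omega) c e (by omega), Nat.cast_succ, add_sub_cancel_right]
        ring

/-- The `q`-Lucas theorem with a wider range for the lower remainder. -/
theorem aeval_qBinom_lucas' (hζ : IsPrimitiveRoot ζ d) (a : ℕ) {b : ℕ} (hb : b < d) (c : ℤ)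
    {x : ℤ} (hx : (b : ℤ) - d < x) (hxd : x < d) :
    aeval ζ (qBinom (a * d + b) (c * d + x)) = binom a c * aeval ζ (qBinom b x) := by
  rcases lt_or_ge x 0 with h | h
  · obtain ⟨e, he⟩ := Int.eq_ofNat_of_zero_le (show 0 ≤ x + d by omega)
    rw [show c * d + x = (c - 1) * d + (e : ℤ) by rw [← he]; ring,
      aeval_qBinom_lucas hζ a hb _ (by omega), qBinom_of_neg b h,
      qBinom_of_lt (show (b : ℤ) < e by omega)]
    simp
  · lift x to ℕ using h
    exact aeval_qBinom_lucas hζ a hb c (by omega)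

/-! ### `q`-ballot numbers and `q`-integers at roots of unity -/

/-- `q`-Lucas applied to both terms. The bound `h1` keeps both lower remainders in the range of
`aeval_qBinom_lucas'`, so they share one binomial factor, which depends on the block c but not on k.
-/
theorem aeval_qBallot (hζ : IsPrimitiveRoot ζ d) {m a b A : ℕ} (hb : b < d)
    (hm : 2 * m = A * d + b) (ha : m / d = a) (c : ℕ) {k : ℕ}
    (h1 : (b : ℤ) - d < (m % d : ℕ) - k - 1) :
    aeval ζ (qBallot m (c * d + k)) = binom A ((a : ℤ) - c) *
      (aeval ζ (qBinom b ((m % d : ℕ) - k)) - aeval ζ (qBinom b ((m % d : ℕ) - k - 1))) := by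
  have hmod : (m : ℤ) = a * d + (m % d : ℕ) := by
    rw [← ha]; exact_mod_cast (Nat.div_add_mod' m d).symm
  have hlt : m % d < d := Nat.mod_lt _ (by omega)
  have e1 : (m : ℤ) - (c * d + k : ℕ) = ((a : ℤ) - c) * d + ((m % d : ℕ) - k) := by
    conv_lhs => rw [hmod]
    push_cast; ring
  rw [qBallot, e1, add_sub_assoc, hm, map_sub, aeval_qBinom_lucas' hζ A hb _ (by omega) (by omega),
    aeval_qBinom_lucas' hζ A hb _ (by omega) (by omega)]
  ring

theorem two_mul_eq_of_le {m d : ℕ} (h : d ≤ 2 * (m % d)) :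
    2 * m = (2 * (m / d) + 1) * d + (2 * (m % d) - d) := by
  have h1 := Nat.div_add_mod' m d
  have h2 : (2 * (m / d) + 1) * d = 2 * (m / d * d) + d := by ring
  omega

/-- At a root of unity, the `q`-ballot numbers are antisymmetric within each block. -/
theorem aeval_qBallot_reflect (hζ : IsPrimitiveRoot ζ d) (hd : 0 < d) {m : ℕ}
    (h : d ≤ 2 * (m % d)) (c : ℕ) {k l : ℕ} (hkl : k + l + 1 = d) :
    aeval ζ (qBallot m (c * d + l)) = -aeval ζ (qBallot m (c * d + k)) := by
  have hlt := Nat.mod_lt m hd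
  rw [aeval_qBallot hζ (by omega) (two_mul_eq_of_le h) rfl c (by omega),
    aeval_qBallot hζ (by omega) (two_mul_eq_of_le h) rfl c (by omega),
    -- Since k + l + 1 = d, the paired lower indices add up to the upper remainder 2(m mod d) - d,
    -- so symmetry interchanges the two terms of the difference.
    qBinom_symm (n := 2 * (m % d) - d)
      (show ((m % d : ℕ) : ℤ) - l + ((m % d : ℕ) - k - 1) = _ by omega),
    qBinom_symm (n := 2 * (m % d) - d)
      (show ((m % d : ℕ) : ℤ) - l - 1 + ((m % d : ℕ) - k) = _ by omega)]
  ring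

/-- Both lower remainders are negative in the first alternative, and exceed the upper remainder 2(m
mod d) - d in the second. -/
theorem aeval_qBallot_eq_zero_of_le (hζ : IsPrimitiveRoot ζ d) {m : ℕ}
    (h : d ≤ 2 * (m % d)) (c : ℕ) {k : ℕ} (hk : k < d)
    (h' : m % d < k ∨ k + m % d + 1 < d) : aeval ζ (qBallot m (c * d + k)) = 0 := by
  have hlt := Nat.mod_lt m (show 0 < d by omega)
  rw [aeval_qBallot hζ (by omega) (two_mul_eq_of_le h) rfl c (by omega)]
  rcases h' with h' | h'
  · rw [qBinom_of_neg _ (by omega), qBinom_of_neg _ (by omega)]; simp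
  · rw [qBinom_of_lt (by omega), qBinom_of_lt (by omega)]; simp

/-- Here the upper remainder is 2(n mod d); `h1` makes both lower remainders negative, and `h2`
keeps them within the range of `q`-Lucas. -/
theorem aeval_qBallot_eq_zero_of_lt (hζ : IsPrimitiveRoot ζ d) {n : ℕ}
    (h : 2 * (n % d) < d) (c : ℕ) {k : ℕ} (h1 : n % d < k) (h2 : k + n % d + 1 < d) :
    aeval ζ (qBallot n (c * d + k)) = 0 := by
  have hn : 2 * n = 2 * (n / d) * d + 2 * (n % d) := by
    have := Nat.div_add_mod' n d
    linarith
  rw [aeval_qBallot hζ h hn rfl c (by omega), qBinom_of_neg _ (by omega),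
    qBinom_of_neg _ (by omega)]
  simp

/-- Within a block, A_n vanishes strictly between ν and d - 1 - ν, and A_m vanishes below d - 1 - μ
and above μ. When μ + ν + 1 < d these ranges cover the block. -/
theorem aeval_qBallot_mul_eq_zero (hζ : IsPrimitiveRoot ζ d) {m n : ℕ}
    (hm : d ≤ 2 * (m % d)) (hmn : m % d + n % d + 1 < d) (k : ℕ) :
    aeval ζ (qBallot m k) * aeval ζ (qBallot n k) = 0 := by
  have hk : k % d < d := Nat.mod_lt k (by omega)
  rw [← Nat.div_add_mod' k d]
  by_cases h : n % d < k % d ∧ k % d + n % d + 1 < d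
  · rw [aeval_qBallot_eq_zero_of_lt hζ (by omega) _ h.1 h.2, mul_zero]
  · rw [aeval_qBallot_eq_zero_of_le hζ hm _ hk (by omega), zero_mul]

theorem aeval_qInt (ζ : K) (n : ℕ) : aeval ζ (qInt n) * (ζ - 1) = ζ ^ n - 1 := by
  rw [qInt, map_sum, ← geom_sum_mul]
  simp

theorem aeval_qInt_eq_zero (hζ : IsPrimitiveRoot ζ d) (hd : 1 < d) {n : ℕ} (h : d ∣ n) :
    aeval ζ (qInt n) = 0 := by
  have := aeval_qInt ζ n
  rw [(hζ.pow_eq_one_iff_dvd n).2 h, sub_self] at this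
  exact (mul_eq_zero.1 this).resolve_right (sub_ne_zero.2 (hζ.ne_one hd))

/-- The symmetric `q`-integer `q^(-k) [2k+1]` is antisymmetric within each block. -/
theorem zpow_mul_aeval_qInt_reflect (hζ : IsPrimitiveRoot ζ d) (hd : 1 < d) {c k l : ℕ}
    (hkl : k + l + 1 = c * d) :
    ζ ^ (-(l : ℤ)) * aeval ζ (qInt (2 * l + 1)) =
      -(ζ ^ (-(k : ℤ)) * aeval ζ (qInt (2 * k + 1))) := by
  have hζ0 : ζ ≠ 0 := hζ.ne_zero (by omega)
  -- After multiplication by ζ - 1 the two quantities are ζ^(l+1) - ζ^(-l) and ζ^(k+1) - ζ^(-k), and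
  -- ζ^(k+l+1) = 1 makes them opposite.
  refine mul_right_cancel₀ (sub_ne_zero.2 (hζ.ne_one hd)) ?_
  rw [neg_mul, mul_assoc, mul_assoc, aeval_qInt, aeval_qInt]
  have h : ζ ^ k * ζ ^ l * ζ = 1 := by
    rw [← pow_add, ← pow_succ, hkl, hζ.pow_eq_one_iff_dvd]; exact dvd_mul_left _ _
  rw [zpow_neg, zpow_neg, zpow_natCast, zpow_natCast]
  field_simp
  linear_combination (ζ ^ k + ζ ^ l) * h

/-! ### Cancellation by reflection within blocks -/

theorem sum_eq_zero_of_reflect [CharZero K] (d N : ℕ) (f : ℕ → K)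
    (hN : ∀ k, N ≤ k → f k = 0) (hd : 0 < d)
    (h : ∀ c k l, k + l + 1 = d → f (c * d + k) + f (c * d + l) = 0) : ∑ k ∈ Finset.range N, f k = 0 := by
  -- The range is extended to N full blocks, which the reflection preserves; the added terms are
  -- zero.
  have hsub : Finset.range N ⊆ Finset.range (N * d) :=
    Finset.range_subset_range.2 (Nat.le_mul_of_pos_right N hd)
  rw [Finset.sum_subset hsub fun k _ hk => hN k (by simpa using hk)]
  have hdm := fun k => Nat.div_add_mod' k d
  have hlt := fun k => Nat.mod_lt k hd
  have hadd : ∀ k, f k + f (k / d * d + (d - 1 - k % d)) = 0 := fun k => by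
    have := h (k / d) (k % d) (d - 1 - k % d) (by have := hlt k; omega)
    rwa [hdm] at this
  have hdiv : ∀ k, (k / d * d + (d - 1 - k % d)) / d = k / d := fun k => by
    rw [mul_comm, Nat.mul_add_div hd, Nat.div_eq_of_lt (show d - 1 - k % d < d by omega), add_zero]
  refine Finset.sum_involution (fun k _ => k / d * d + (d - 1 - k % d)) (fun k _ => hadd k)
    -- A fixed point of the reflection has 2 f(k) = 0, hence f(k) = 0 in characteristic zero.
    (fun k _ hk heq => hk (add_self_eq_zero.1 ?_)) (fun k hk => ?_) (fun k _ => ?_)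
  · have := hadd k
    rwa [heq] at this
  · rw [Finset.mem_range, ← Nat.div_lt_iff_lt_mul hd] at hk ⊢
    rwa [hdiv]
  · have h1 : (k / d * d + (d - 1 - k % d)) % d = d - 1 - k % d := by
      rw [mul_comm, Nat.mul_add_mod, Nat.mod_eq_of_lt (by omega)]
    simp only [hdiv, h1]
    have := hdm k
    have := hlt k
    omega

theorem mem_superCatalanIndices {m n d : ℕ} (h : d ∈ superCatalanIndices m n) :
    1 < d ∧ (d ≤ 2 * (m % d) ∨ d ≤ 2 * (n % d)) ∧
      (m % d + n % d < d ∨ (d ≤ 2 * (m % d) ∧ d ≤ 2 * (n % d))) := by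
  simp only [superCatalanIndices, Finset.mem_filter, Finset.mem_Icc] at h
  exact ⟨by omega, h.2⟩

/-- The common form of the sums: `W` is a weight that is symmetric within each block at every root
of unity. -/
theorem toL_qSuperCatalan_dvd_sum {m n r s t : ℕ} (hs : s ≠ 0) (ht : t ≠ 0)
    (hodd : Odd (r + s + t)) (W : ℕ → LaurentPolynomial ℤ)
    (hW : ∀ d, 1 < d → ∀ u : ℂˣ, IsPrimitiveRoot (u : ℂ) d → ∀ c k l, k + l + 1 = (2 * c + 1) * d →
      evalL u (W l) = evalL u (W k)) :
    toL (qSuperCatalan m n) ∣ toL (qInt (m + n + 1)) * ∑ k ∈ Finset.range (m + 1),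
      W k * ((qPow (-(k : ℤ)) * toL (qInt (2 * k + 1))) ^ r * toL (qBallot m k) ^ s *
        toL (qBallot n k) ^ t) := by
  refine toL_qSuperCatalan_dvd fun d hd u hu => ?_
  obtain ⟨hd1, hor, hcases⟩ := mem_superCatalanIndices hd
  have hd0 : 0 < d := by omega
  simp only [map_mul, map_sum, map_pow, evalL_toL, evalL_qPow, Units.val_zpow_eq_zpow_val]
  by_cases hboth : d ≤ 2 * (m % d) ∧ d ≤ 2 * (n % d)
  · refine mul_eq_zero_of_right _ (sum_eq_zero_of_reflect d _ _ (fun k hk => ?_) hd0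
      fun c k l hkl => ?_)
    · rw [qBallot_of_lt (show m < k by omega)]
      simp [hs]
    · have hkl' : c * d + k + (c * d + l) + 1 = (2 * c + 1) * d := by rw [← hkl]; ring
      rw [hW d hd1 u hu c _ _ hkl', zpow_mul_aeval_qInt_reflect hu hd1 hkl',
        aeval_qBallot_reflect hu hd0 hboth.1 c hkl, aeval_qBallot_reflect hu hd0 hboth.2 c hkl,
        neg_pow _ r, neg_pow _ s, neg_pow _ t]
      have h := hodd.neg_one_pow (α := ℂ)
      rw [pow_add, pow_add] at h
      set w := evalL u (W (c * d + k))
      set x := ((u : ℂ) ^ (-((c * d + k : ℕ) : ℤ)) *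
        aeval (u : ℂ) (qInt (2 * (c * d + k) + 1))) ^ r
      set y := aeval (u : ℂ) (qBallot m (c * d + k)) ^ s
      set z := aeval (u : ℂ) (qBallot n (c * d + k)) ^ t
      linear_combination w * x * y * z * h
  · have hlt : m % d + n % d < d := hcases.resolve_right hboth
    rcases (show m % d + n % d + 1 ≤ d from hlt).lt_or_eq with hlt' | heq
    · refine mul_eq_zero_of_right _ (Finset.sum_eq_zero fun k _ => ?_)
      have h0 : aeval (u : ℂ) (qBallot m k) * aeval (u : ℂ) (qBallot n k) = 0 := by
        rcases hor with h | h
        · exact aeval_qBallot_mul_eq_zero hu h hlt' k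
        · rw [mul_comm]
          exact aeval_qBallot_mul_eq_zero hu h (by omega) k
      rcases mul_eq_zero.1 h0 with h0 | h0 <;> simp [h0, hs, ht]
    · refine mul_eq_zero_of_left (aeval_qInt_eq_zero hu hd1 ⟨m / d + n / d + 1, ?_⟩) _
      have h1 := Nat.div_add_mod m d
      have h2 := Nat.div_add_mod n d
      linarith

/-! ### Reflection symmetry of the weights -/

/-- The reflection `k ↦ c d - 1 - k` fixes `k² + k` modulo `d`. -/
theorem pow_sq_add_reflect {K : Type*} [Field K] {ζ : K} {d : ℕ} (hζ : IsPrimitiveRoot ζ d)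
    (j : ℕ) {c k l : ℕ} (hkl : k + l + 1 = c * d) :
    ζ ^ ((j : ℤ) * ((l : ℤ) ^ 2 + l)) = ζ ^ ((j : ℤ) * ((k : ℤ) ^ 2 + k)) := by
  rcases Nat.eq_zero_or_pos d with rfl | hd
  · omega
  have hl : (l : ℤ) = c * d - 1 - k := by zify at hkl; linarith
  have : (j : ℤ) * ((l : ℤ) ^ 2 + l) = (d : ℤ) * (j * c * (c * d - 1 - 2 * k)) +
      (j : ℤ) * ((k : ℤ) ^ 2 + k) := by rw [hl]; ring
  rw [this, zpow_add₀ (hζ.ne_zero hd.ne'), zpow_mul, zpow_natCast, hζ.pow_eq_one, one_zpow,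
    one_mul]

theorem succ_choose_two_mul_two (i : ℕ) : (i + 1).choose 2 * 2 = i * (i + 1) := by
  rw [Nat.choose_two_right, Nat.add_sub_cancel, mul_comm (i + 1),
    Nat.div_mul_cancel (Nat.even_mul_succ_self i).two_dvd]

/-- The exponent is i(2c + 1)d/2. For even d use ζ^(d/2) = -1 and the oddness of 2c + 1; for odd d,
i is even and the exponent is a multiple of d. -/
theorem pow_choose_two_eq_neg_one_pow {K : Type*} [Field K] {ζ : K} {d : ℕ}
    (hζ : IsPrimitiveRoot ζ d) {c i : ℕ} (h : i + 1 = (2 * c + 1) * d) :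
    ζ ^ (i + 1).choose 2 = (-1) ^ i := by
  have hi := succ_choose_two_mul_two i
  rcases Nat.even_or_odd' d with ⟨e, rfl | rfl⟩
  · have he : 0 < e := Nat.pos_of_ne_zero fun h0 => by simp [h0] at h
    have hhalf : ζ ^ e = -1 := by
      have h1 : (ζ ^ e - 1) * (ζ ^ e + 1) = 0 := by
        have := hζ.pow_eq_one
        rw [mul_comm 2 e, pow_mul] at this
        linear_combination this
      have h2 : ζ ^ e ≠ 1 := hζ.pow_ne_one_of_pos_of_lt (by omega) (by omega)
      exact eq_neg_of_add_eq_zero_left ((mul_eq_zero.1 h1).resolve_left (sub_ne_zero.2 h2))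
    have hexp : (i + 1).choose 2 = e * ((2 * c + 1) * i) := by
      have : i * (i + 1) = 2 * (e * ((2 * c + 1) * i)) := by rw [h]; ring
      linarith
    rw [hexp, pow_mul, hhalf, pow_mul, Odd.neg_one_pow ⟨c, rfl⟩]
  · obtain ⟨a, rfl⟩ : ∃ a, i = 2 * a := ⟨2 * c * e + c + e, by linarith⟩
    have hexp : (2 * a + 1).choose 2 = (2 * e + 1) * ((2 * c + 1) * a) := by
      have : 2 * a * (2 * a + 1) = 2 * ((2 * e + 1) * ((2 * c + 1) * a)) := by rw [h]; ring
      linarith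
    rw [hexp, pow_mul, hζ.pow_eq_one, one_pow, pow_mul]
    simp

/-- The reflection `k ↦ (2 c + 1) d - 1 - k` fixes `(-1)^k q^(k (k + 1) / 2)`. -/
theorem neg_one_pow_mul_pow_choose_reflect {K : Type*} [Field K] {ζ : K} {d : ℕ}
    (hζ : IsPrimitiveRoot ζ d) {c k l : ℕ} (hkl : k + l + 1 = (2 * c + 1) * d) :
    (-1) ^ l * ζ ^ (l + 1).choose 2 = (-1) ^ k * ζ ^ (k + 1).choose 2 := by
  have hexp : (l + 1).choose 2 + (k + l + 1) * k = (k + 1).choose 2 + (k + l + 1).choose 2 := by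
    have hk := succ_choose_two_mul_two k
    have hl := succ_choose_two_mul_two l
    have hi := succ_choose_two_mul_two (k + l)
    linarith
  have h1 : ζ ^ (k + l + 1) = 1 := (hζ.pow_eq_one_iff_dvd _).2 (hkl ▸ dvd_mul_left _ _)
  have h : ζ ^ (l + 1).choose 2 = ζ ^ (k + 1).choose 2 * (-1) ^ (k + l) := by
    rw [← pow_choose_two_eq_neg_one_pow hζ hkl, ← pow_add, ← hexp, pow_add, pow_mul, h1, one_pow,
      mul_one]
  have hsq : ((-1 : K) ^ l) * (-1) ^ l = 1 := by rw [← mul_pow]; simp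
  rw [h, pow_add]
  linear_combination (-1) ^ k * ζ ^ (k + 1).choose 2 * hsq

/-! ### The two sums in the common form -/

theorem qPow_add (a b : ℤ) : qPow (a + b) = qPow a * qPow b := LaurentPolynomial.T_add a b

theorem qPow_natCast_mul (r : ℕ) (a : ℤ) : qPow (r * a) = qPow a ^ r :=
  (LaurentPolynomial.T_pow a r).symm

theorem qSum_eq (m n s t j r : ℕ) :
    qSum m n s t j r = ∑ k ∈ Finset.range (m + 1), qPow ((j : ℤ) * ((k : ℤ) ^ 2 + k)) *
      ((qPow (-(k : ℤ)) * toL (qInt (2 * k + 1))) ^ r * toL (qBallot m k) ^ s *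
        toL (qBallot n k) ^ t) := by
  refine Finset.sum_congr rfl fun k _ => ?_
  rw [show (j : ℤ) * ((k : ℤ) ^ 2 + k) - r * k = j * ((k : ℤ) ^ 2 + k) + r * (-k) by ring,
    qPow_add, qPow_natCast_mul r]
  simp only [map_mul, map_pow, mul_pow]
  ring

theorem qAltSum_eq (m n s t j r : ℕ) :
    qAltSum m n s t j r = ∑ k ∈ Finset.range (m + 1),
      ((-1) ^ k * qPow ((k + 1).choose 2 : ℕ) * qPow ((j : ℤ) * ((k : ℤ) ^ 2 + k))) *
      ((qPow (-(k : ℤ)) * toL (qInt (2 * k + 1))) ^ r * toL (qBallot m k) ^ s *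
        toL (qBallot n k) ^ t) := by
  refine Finset.sum_congr rfl fun k _ => ?_
  -- The extra k in -(r - 1)k turns C(k,2) into C(k+1,2), leaving q^(-rk) for the symmetric
  -- `q`-integers.
  have hchoose : (k + 1).choose 2 = k + k.choose 2 := by simp [Nat.choose_succ_succ' k 1]
  rw [show (k.choose 2 : ℤ) + (j : ℤ) * ((k : ℤ) ^ 2 + k) - ((r : ℤ) - 1) * k =
      ((k + 1).choose 2 : ℕ) + j * ((k : ℤ) ^ 2 + k) + r * (-k) by
        rw [hchoose]; push_cast; ring,
    qPow_add, qPow_add, qPow_natCast_mul r]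
  simp only [map_mul, map_pow, mul_pow]
  ring

theorem toL_qSuperCatalan_dvd_qSum {m n r s t : ℕ} (hs : s ≠ 0) (ht : t ≠ 0)
    (hodd : Odd (r + s + t)) (j : ℕ) :
    toL (qSuperCatalan m n) ∣ toL (qInt (m + n + 1)) * qSum m n s t j r := by
  rw [qSum_eq]
  refine toL_qSuperCatalan_dvd_sum hs ht hodd _ fun d _ u hu c k l hkl => ?_
  rw [evalL_qPow, evalL_qPow, Units.val_zpow_eq_zpow_val, Units.val_zpow_eq_zpow_val,
    pow_sq_add_reflect hu j hkl]

theorem toL_qSuperCatalan_dvd_qAltSum {m n r s t : ℕ} (hs : s ≠ 0) (ht : t ≠ 0)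
    (hodd : Odd (r + s + t)) (j : ℕ) :
    toL (qSuperCatalan m n) ∣ toL (qInt (m + n + 1)) * qAltSum m n s t j r := by
  rw [qAltSum_eq]
  refine toL_qSuperCatalan_dvd_sum hs ht hodd _ fun d _ u hu c k l hkl => ?_
  simp only [map_mul, map_pow, map_neg, map_one, evalL_qPow, Units.val_zpow_eq_zpow_val]
  rw [pow_sq_add_reflect hu j hkl, zpow_natCast, zpow_natCast,
    neg_one_pow_mul_pow_choose_reflect hu hkl]

/-! ### Specialization to q = 1 -/

theorem eval_one_qInt (n : ℕ) : (qInt n).eval 1 = n := by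
  simp [qInt, eval_finsetSum]

theorem eval_one_qFactorial (n : ℕ) : (qFactorial n).eval 1 = n.factorial := by
  rw [qFactorial, eval_prod, ← Finset.prod_range_add_one_eq_factorial, Nat.cast_prod]
  simp [eval_one_qInt]

theorem eval_one_qBinom (n : ℕ) (k : ℤ) : (qBinom n k).eval 1 = binom n k := by
  rcases lt_or_ge k 0 with h | h
  · rw [qBinom_of_neg _ h, binom_of_neg _ h, eval_zero]
  lift k to ℕ using h
  rw [binom_natCast]
  induction n generalizing k with
  | zero =>
    cases k with
    | zero => rw [Nat.cast_zero, qBinom_zero]; simp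
    | succ k => rw [qBinom_of_lt (by omega)]; simp
  | succ n ih =>
    cases k with
    | zero => rw [Nat.cast_zero, qBinom_zero]; simp
    | succ k => rw [qBinom_succ, eval_add, eval_mul, ih, ih, Nat.choose_succ_succ']; simp

theorem eval_one_qBallot (n k : ℕ) : (qBallot n k).eval 1 = ballot n k := by
  rw [qBallot, ballot, eval_sub, eval_one_qBinom, eval_one_qBinom]

theorem factorial_mul_eval_one_qSuperCatalan (m n : ℕ) :
    (((m + n).factorial * m.factorial * n.factorial : ℕ) : ℤ) * (qSuperCatalan m n).eval 1 =
      ((2 * m).factorial * (2 * n).factorial : ℕ) := by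
  have h := congrArg (eval 1) (qSuperCatalanDen_mul_qSuperCatalan m n)
  rw [qSuperCatalanDen] at h
  simp only [eval_mul, eval_one_qFactorial] at h
  exact_mod_cast h

theorem factorial_mul_superCatalan (m n : ℕ) :
    (m + n).factorial * m.factorial * n.factorial * superCatalan m n =
      (2 * m).factorial * (2 * n).factorial :=
  Nat.mul_div_cancel' (Int.natCast_dvd_natCast.1
    ⟨_, (factorial_mul_eval_one_qSuperCatalan m n).symm⟩)

theorem eval_one_qSuperCatalan (m n : ℕ) : (qSuperCatalan m n).eval 1 = superCatalan m n := by
  have h0 : (((m + n).factorial * m.factorial * n.factorial : ℕ) : ℤ) ≠ 0 := by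
    exact_mod_cast (by positivity)
  refine mul_left_cancel₀ h0 ?_
  rw [factorial_mul_eval_one_qSuperCatalan, ← factorial_mul_superCatalan, Nat.cast_mul]

theorem evalL_one_toL (p : ℤ[X]) : evalL (1 : ℤˣ) (toL p) = p.eval 1 := by
  rw [evalL_toL, Units.val_one, coe_aeval_eq_eval]

theorem evalL_one_qSum (m n s t j r : ℕ) : evalL (1 : ℤˣ) (qSum m n s t j r) =
    ∑ k ∈ Finset.range (m + 1), (2 * (k : ℤ) + 1) ^ r * ballot m k ^ s * ballot n k ^ t := by
  rw [qSum, map_sum]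
  refine Finset.sum_congr rfl fun k _ => ?_
  rw [map_mul, evalL_qPow, evalL_one_toL]
  simp [eval_one_qInt, eval_one_qBallot]

theorem evalL_one_qAltSum (m n s t j r : ℕ) : evalL (1 : ℤˣ) (qAltSum m n s t j r) =
    ∑ k ∈ Finset.range (m + 1),
      (-1) ^ k * (2 * (k : ℤ) + 1) ^ r * ballot m k ^ s * ballot n k ^ t := by
  rw [qAltSum, map_sum]
  refine Finset.sum_congr rfl fun k _ => ?_
  rw [map_mul, map_mul, evalL_qPow, evalL_one_toL]
  simp [eval_one_qInt, eval_one_qBallot, mul_assoc]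

theorem superCatalan_dvd_of_toL_dvd {m n : ℕ} {f : LaurentPolynomial ℤ}
    (h : toL (qSuperCatalan m n) ∣ toL (qInt (m + n + 1)) * f) :
    (superCatalan m n : ℤ) ∣ ((m : ℤ) + n + 1) * evalL (1 : ℤˣ) f := by
  have := map_dvd (evalL (1 : ℤˣ)) h
  rw [map_mul, evalL_one_toL, evalL_one_toL, eval_one_qSuperCatalan, eval_one_qInt] at this
  exact_mod_cast this

end QBallot

/-- Divisibility of the sum and of the alternating sum by the `q`-super Catalan number, in the
ring of Laurent polynomials in `q` with integer coefficients, together with the case `q = 1`.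
The first conjunct and the fourth one say that the fractions that define the (`q`-)super Catalan
numbers are exact quotients. -/
theorem theorem1p4 (m n s t j r : ℕ) (hm : 1 ≤ m) (hn : 1 ≤ n) (hs : 1 ≤ s) (ht : 1 ≤ t)
    (hodd : Odd (r + s + t)) (hj : j ≤ s + t) :
    (QBallot.qSuperCatalanDen m n * QBallot.qSuperCatalan m n =
        QBallot.qFactorial (2 * m) * QBallot.qFactorial (2 * n)) ∧
    (QBallot.toL (QBallot.qSuperCatalan m n) ∣
        QBallot.toL (QBallot.qInt (m + n + 1)) * QBallot.qSum m n s t j r) ∧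
    (QBallot.toL (QBallot.qSuperCatalan m n) ∣
        QBallot.toL (QBallot.qInt (m + n + 1)) * QBallot.qAltSum m n s t j r) ∧
    ((m + n).factorial * m.factorial * n.factorial * QBallot.superCatalan m n =
        (2 * m).factorial * (2 * n).factorial) ∧
    ((QBallot.superCatalan m n : ℤ) ∣
        ((m : ℤ) + n + 1) * ∑ k ∈ Finset.range (m + 1),
          (2 * (k : ℤ) + 1) ^ r * QBallot.ballot m k ^ s * QBallot.ballot n k ^ t) ∧
    ((QBallot.superCatalan m n : ℤ) ∣
        ((m : ℤ) + n + 1) * ∑ k ∈ Finset.range (m + 1),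
          (-1) ^ k * (2 * (k : ℤ) + 1) ^ r * QBallot.ballot m k ^ s *
            QBallot.ballot n k ^ t) := by
  have h1 := QBallot.toL_qSuperCatalan_dvd_qSum (m := m) (n := n) (Nat.ne_of_gt hs)
    (Nat.ne_of_gt ht) hodd j
  have h2 := QBallot.toL_qSuperCatalan_dvd_qAltSum (m := m) (n := n) (Nat.ne_of_gt hs)
    (Nat.ne_of_gt ht) hodd j
  refine ⟨QBallot.qSuperCatalanDen_mul_qSuperCatalan m n, h1, h2,
    QBallot.factorial_mul_superCatalan m n, ?_, ?_⟩
  · rw [← QBallot.evalL_one_qSum m n s t j r]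
    exact QBallot.superCatalan_dvd_of_toL_dvd h1
  · rw [← QBallot.evalL_one_qAltSum m n s t j r]
    exact QBallot.superCatalan_dvd_of_toL_dvd h2
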